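/- Let $(a_\nu)_{\nu\ge 1}$ be a sequence of non-zero real numbers with $\sum_{\nu} a_\nu^{-2}<\infty$, and put $a_0:=\min_{\nu\ge1}|a_\nu|$. A measurable, non-constant function $f:\mathbb R\to\mathbb R$ is called totally positive (TP) if for every $N$ and all real numbers $x_1<\dots<x_N$, $y_1<\dots<y_N$ one has $\det\big(f(x_j-y_k)\big)_{j,k=1}^N\ge 0$. With $\hat f(\omega)=\int_{\mathbb R} f(t)e^{-2\pi i t\omega}\,dt$, let $g$ be an integrable TP function (of infinite type) with $$\hat g(\omega)=\prod_{\nu=1}^{\infty}\frac{e^{2\pi i\omega/a_\nu}}{1+2\pi i\omega/a_\nu},\qquad \omega\in\mathbb R,$$ and, for every integer $n\ge 1$, let $g_n$ be an integrable TP function (of finite type $n$) with $$\hat g_n(\omega)=\prod_{\nu=1}^{n}\frac{e^{2\pi i\omega/a_\nu}}{1+2\pi i\omega/a_\nu},\qquad \omega\in\mathbb R.$$ For $x\in\mathbb R$ and $s\in\mathbb C$ let $\mathrm Zf(x,s)=\sum_{k\in\mathbb Z}f(x+k)e^{-2\pi i k s}$ be the complexified Zak transform. Let $0\le\xi<\frac{a_0}{2\pi}$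 and $S_\xi=\{s\in\mathbb C : |\operatorname{Im} s|\le\xi\}$. Then: 1. For every fixed $x_0\in[0,1)$, the series defining $\mathrm Zg(x_0,s)$ and $\mathrm Zg_n(x_0,s)$, $n\ge1$, converge absolutely for all $s\in S_\xi$, and the functions $\mathrm Zg(x_0,\cdot)$ and $\mathrm Zg_n(x_0,\cdot)$ are holomorphic in $S_\xi$ (that is, in a neighbourhood of every point of $S_\xi$). 2. $\lim_{n\to\infty}|\mathrm Zg(x,s)-\mathrm Zg_n(x,s)|=0$ uniformly for all $s\in S_\xi$ and all $x\in[0,1)$. -/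

import Mathlib

open Filter MeasureTheory Set
open scoped FourierTransform Topology

/-- A totally positive function in Schoenberg's sense: a measurable, non-constant function `g` on
the real line such that all matrices `(g (x_j - y_k))` with `x_1 < ... < x_N` and
`y_1 < ... < y_N` have non-negative determinant. -/
structure IsTotallyPositive (g : ℝ → ℝ) : Prop where
  measurable : Measurable g
  nonconstant : ∃ x y : ℝ, g x ≠ g y
  det_nonneg : ∀ (N : ℕ) (x y : Fin N → ℝ), StrictMono x → StrictMono y →
    0 ≤ (Matrix.of fun j k => g (x j - y k)).det

/-- The factor `e^{2πiω/a} / (1 + 2πiω/a)`. -/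
noncomputable def tpFactor (a ω : ℝ) : ℂ :=
  Complex.exp (2 * Real.pi * Complex.I * ω / a) / (1 + 2 * Real.pi * Complex.I * ω / a)

/-- `g` is an integrable totally positive function of finite type `n`, whose Fourier transform is
the product of the factors belonging to the first `n` parameters `a 0, ..., a (n - 1)`. -/
structure IsTPOfFiniteType (a : ℕ → ℝ) (n : ℕ) (g : ℝ → ℝ) : Prop where
  totallyPositive : IsTotallyPositive g
  integrable : Integrable g
  fourier_eq : ∀ ω : ℝ, 𝓕 (fun x : ℝ => (g x : ℂ)) ω = ∏ ν ∈ Finset.range n, tpFactor (a ν) ω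

/-- `g` is an integrable totally positive function of infinite type, whose Fourier transform is
the product of the factors belonging to all the parameters. -/
structure IsTPOfInfiniteType (a : ℕ → ℝ) (g : ℝ → ℝ) : Prop where
  totallyPositive : IsTotallyPositive g
  integrable : Integrable g
  fourier_eq : ∀ ω : ℝ, 𝓕 (fun x : ℝ => (g x : ℂ)) ω = ∏' ν : ℕ, tpFactor (a ν) ω

/-- The `k`-th term `f(x + k) e^{-2πiks}` of the complexified Zak transform. -/
noncomputable def zakTerm (f : ℝ → ℝ) (x : ℝ) (s : ℂ) (k : ℤ) : ℂ :=
  (f (x + k) : ℂ) * Complex.exp (-2 * Real.pi * Complex.I * k * s)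

/-- The complexified Zak transform `Zf(x, s) = ∑_{k ∈ ℤ} f(x + k) e^{-2πiks}`. -/
noncomputable def zak (f : ℝ → ℝ) (x : ℝ) (s : ℂ) : ℂ :=
  ∑' k : ℤ, zakTerm f x s k

/-- The closed horizontal strip `|Im s| ≤ ξ`. -/
def strip (ξ : ℝ) : Set ℂ := {s : ℂ | |s.im| ≤ ξ}

/-! ### Fourier inversion almost everywhere -/

theorem integral_fourier_mul_eq {f g : ℝ → ℂ} (hf : Integrable f) (hg : Integrable g) :
    ∫ x, 𝓕 f x * g x = ∫ x, f x * 𝓕 g x := by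
  simpa using! VectorFourier.integral_fourierIntegral_smul_eq_flip (L := innerₗ ℝ)
      Real.continuous_fourierChar continuous_inner hf hg

theorem continuous_fourierInv_of_integrable {G : ℝ → ℂ} (hG : Integrable G) :
    Continuous (𝓕⁻ G) := by
  have h : Continuous (𝓕 G) := VectorFourier.fourierIntegral_continuous
    Real.continuous_fourierChar (L := innerₗ ℝ) continuous_inner hG
  have : 𝓕⁻ G = fun x => 𝓕 G (-x) := funext fun x => Real.fourierInv_eq_fourier_neg G x
  rw [this]
  exact h.comp continuous_neg

theorem ae_eq_fourierInv_of_fourier_eq {f G : ℝ → ℂ} (hf : Integrable f) (hG : Integrable G)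
    (h : ∀ ω, 𝓕 f ω = G ω) : ∀ᵐ x, f x = 𝓕⁻ G x := by
  have hFG : 𝓕 f = G := funext h
  refine ae_eq_of_integral_contDiff_smul_eq hf.locallyIntegrable
    (continuous_fourierInv_of_integrable hG).locallyIntegrable fun ψ hψ hψc => ?_
  have hs : ContDiff ℝ (⊤ : ℕ∞) fun x => (ψ x : ℂ) := Complex.ofRealCLM.contDiff.comp hψ
  have hc : HasCompactSupport fun x => (ψ x : ℂ) := hψc.comp_left (g := Complex.ofReal) (by simp)
  let Ψ : SchwartzMap ℝ ℂ := hc.toSchwartzMap hs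
  let φ : SchwartzMap ℝ ℂ := 𝓕⁻ Ψ
  have hφ : 𝓕 (φ : ℝ → ℂ) = fun x => (ψ x : ℂ) := by
    rw [← SchwartzMap.fourier_coe, FourierTransform.fourier_fourierInv_eq]
    rfl
  have hΨ : 𝓕 (fun x => Ψ (-x)) = (φ : ℝ → ℂ) := by
    rw [← Real.fourierInv_eq_fourier_comp_neg, ← SchwartzMap.fourierInv_coe]
  have h1 : ∫ x, (ψ x : ℂ) * f x = ∫ x, φ x * G x := by
    rw [← hFG, ← integral_fourier_mul_eq φ.integrable hf, hφ]
  have h2 : ∫ x, (ψ x : ℂ) * 𝓕⁻ G x = ∫ x, φ x * G x := by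
    rw [← hΨ, integral_fourier_mul_eq Ψ.integrable.comp_neg hG,
      ← integral_neg_eq_self]
    refine integral_congr_ae (.of_forall fun x => ?_)
    simp only [Real.fourierInv_eq_fourier_neg, neg_neg]
    rfl
  simpa using h1.trans h2.symm

/-! ### Regularity of totally positive functions -/

namespace IsTotallyPositive

variable {g : ℝ → ℝ}

theorem nonneg (hg : IsTotallyPositive g) (x : ℝ) : 0 ≤ g x := by
  simpa using hg.det_nonneg 1 (fun _ => x) (fun _ => 0) (Subsingleton.strictMono _)
    (Subsingleton.strictMono _)

theorem mul_le_mul_of_lt (hg : IsTotallyPositive g) {x y t : ℝ} (ht : 0 < t) (hxy : x + t < y) :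
    g x * g y ≤ g (x + t) * g (y - t) := by
  have h := hg.det_nonneg 2 ![x + t, y] ![0, t]
    (by simpa [Fin.strictMono_iff_lt_succ] using hxy)
    (by simpa [Fin.strictMono_iff_lt_succ] using ht)
  simp only [Matrix.det_fin_two, Matrix.of_apply] at h
  simp at h
  linarith

theorem exists_ne_pos (hg : IsTotallyPositive g) (h0 : ¬ g =ᵐ[volume] 0) (x : ℝ) :
    ∃ y ≠ x, 0 < g y := by
  by_contra! h
  refine h0 ?_
  filter_upwards [Measure.ae_ne volume x] with y hy
  exact le_antisymm (h y hy) (hg.nonneg y)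

/-- A majorization valid almost everywhere by a continuous function transfers to products. -/
theorem mul_le_mul_of_ae_le (hg : IsTotallyPositive g) {h : ℝ → ℝ} (hh : Continuous h)
    (hgh : ∀ᵐ x, g x ≤ h x) {x y : ℝ} (hxy : x ≠ y) : g x * g y ≤ h x * h y := by
  wlog hlt : x < y generalizing x y
  · rw [mul_comm (g x), mul_comm (h x)]
    exact this hxy.symm (lt_of_le_of_ne (not_lt.1 hlt) hxy.symm)
  have hp : ∀ᵐ t, g (x + t) ≤ h (x + t) :=
    (measurePreserving_add_left volume x).quasiMeasurePreserving.ae hgh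
  have hm : ∀ᵐ t, g (y - t) ≤ h (y - t) :=
    (Measure.measurePreserving_sub_left volume y).quasiMeasurePreserving.ae hgh
  have hfr : ∃ᶠ t in 𝓝[>] (0 : ℝ), g x * g y ≤ h (x + t) * h (y - t) := by
    have hev : ∀ᶠ t in 𝓝[>] (0 : ℝ), t ∈ Ioo 0 (y - x) := Ioo_mem_nhdsGT (by linarith)
    have hae : ∃ᶠ t in 𝓝[>] (0 : ℝ), g (x + t) ≤ h (x + t) ∧ g (y - t) ≤ h (y - t) := by
      rw [frequently_iff]
      intro U hU
      obtain ⟨ε, hε, hεU⟩ := mem_nhdsGT_iff_exists_Ioo_subset.1 hU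
      have hpos : volume (Ioo (0 : ℝ) ε) ≠ 0 := by
        simpa using hε
      obtain ⟨t, ht, ht'⟩ := ((frequently_ae_iff (p := fun t => t ∈ Ioo (0 : ℝ) ε)).2
        hpos).and_eventually (hp.and hm) |>.exists
      exact ⟨t, hεU ht, ht'⟩
    refine (hae.and_eventually hev).mono fun t ht => ?_
    obtain ⟨⟨h1, h2⟩, h3, h4⟩ := ht
    exact (hg.mul_le_mul_of_lt h3 (by linarith)).trans
      (mul_le_mul h1 h2 (hg.nonneg _) ((hg.nonneg _).trans h1))
  have hlim : Tendsto (fun t => h (x + t) * h (y - t)) (𝓝[>] 0) (𝓝 (h x * h y)) := by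
    have : Continuous fun t => h (x + t) * h (y - t) := by fun_prop
    simpa using (this.tendsto 0).mono_left nhdsWithin_le_nhds
  exact ge_of_tendsto_of_frequently hlim hfr

theorem eq_of_ae_eq (hg : IsTotallyPositive g) (h0 : ¬ g =ᵐ[volume] 0) {h : ℝ → ℝ}
    (hh : Continuous h) (hgh : g =ᵐ[volume] h) (x : ℝ) : g x = h x := by
  have hnn : ∀ x, 0 ≤ h x := by
    intro x
    have hcl : IsClosed {x | 0 ≤ h x} := isClosed_le continuous_const hh
    have hd : Dense {x | 0 ≤ h x} := by
      refine Measure.dense_of_ae (μ := volume) ?_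
      filter_upwards [hgh] with x hx
      exact hx ▸ hg.nonneg x
    have := hcl.closure_eq ▸ hd.closure_eq
    exact (this ▸ mem_univ x : x ∈ {x | 0 ≤ h x})
  have hle : ∀ x, h x ≤ g x := by
    intro x
    have hp : ∀ᵐ t, g (x + t) = h (x + t) :=
      (measurePreserving_add_left volume x).quasiMeasurePreserving.ae hgh
    have hm : ∀ᵐ t, g (x - t) = h (x - t) :=
      (Measure.measurePreserving_sub_left volume x).quasiMeasurePreserving.ae hgh
    have hcl : IsClosed {t | h (x - t) * h (x + t) ≤ g x * g x} :=
      isClosed_le (by fun_prop) continuous_const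
    have hd : Dense {t | h (x - t) * h (x + t) ≤ g x * g x} := by
      refine Measure.dense_of_ae (μ := volume) ?_
      filter_upwards [hp, hm, Measure.ae_ne volume 0] with t h1 h2 h3
      rw [← h1, ← h2]
      rcases lt_or_gt_of_ne h3 with h | h
      · have := hg.mul_le_mul_of_lt (x := x + t) (y := x - t) (t := -t) (by linarith)
          (by linarith)
        simp only [add_neg_cancel_right, sub_neg_eq_add, sub_add_cancel] at this
        linarith
      · have := hg.mul_le_mul_of_lt (x := x - t) (y := x + t) (t := t) h (by linarith)
        simpa using this
    have h0 := (hcl.closure_eq ▸ hd.closure_eq) ▸ mem_univ (0 : ℝ)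
    rw [mem_ofPred_eq] at h0
    simp only [sub_zero, add_zero] at h0
    exact abs_le_of_sq_le_sq' (by simpa [sq] using h0) (hg.nonneg x) |>.2
  refine le_antisymm ?_ (hle x)
  obtain ⟨y, hyx, hy⟩ := hg.exists_ne_pos h0 x
  have h1 := hg.mul_le_mul_of_ae_le hh (hgh.mono fun _ => le_of_eq) hyx.symm
  by_cases hhy : 0 < h y
  · refine le_of_mul_le_mul_right ?_ hhy
    exact (mul_le_mul_of_nonneg_left (hle y) (hg.nonneg x)).trans h1
  · have : h y = 0 := le_antisymm (not_lt.1 hhy) (hnn y)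
    rw [this, mul_zero] at h1
    have : g x = 0 := by
      have := hg.nonneg x
      by_contra hne
      have : 0 < g x := lt_of_le_of_ne this (Ne.symm hne)
      nlinarith
    exact this ▸ hnn x

theorem exists_le_mul_of_ae_le (hg : IsTotallyPositive g) (h0 : ¬ g =ᵐ[volume] 0) {h : ℝ → ℝ}
    (hh : Continuous h) (hpos : ∀ x, 0 < h x) (hgh : ∀ᵐ x, g x ≤ h x) :
    ∃ C, ∀ x, g x ≤ C * h x := by
  obtain ⟨p, -, hp⟩ := hg.exists_ne_pos h0 0
  refine ⟨max (h p / g p) (g p / h p), fun x => ?_⟩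
  by_cases hx : x = p
  · subst hx
    calc g x = g x / h x * h x := by field_simp [(hpos x).ne']
      _ ≤ _ := mul_le_mul_of_nonneg_right (le_max_right _ _) (hpos x).le
  · calc g x ≤ h p / g p * h x := by
          rw [div_mul_eq_mul_div, le_div_iff₀ hp, mul_comm (h p)]
          exact hg.mul_le_mul_of_ae_le hh hgh hx
      _ ≤ _ := mul_le_mul_of_nonneg_right (le_max_left _ _) (hpos x).le

end IsTotallyPositive

/-! ### Shifting the line of integration -/

theorem integrable_vertical_line {F : ℂ → ℂ} {ρ C τ : ℝ} (hτ : |τ| ≤ ρ)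
    (hF : ∀ z : ℂ, |z.re| ≤ ρ → DifferentiableAt ℂ F z)
    (hC : ∀ z : ℂ, |z.re| ≤ ρ → ‖F z‖ ≤ C * (1 + z.im ^ 2)⁻¹) :
    Integrable fun y : ℝ => F (τ + y * Complex.I) := by
  refine (integrable_inv_one_add_sq.const_mul C).mono' ?_ (.of_forall fun y => ?_)
  · refine Continuous.aestronglyMeasurable ?_
    rw [continuous_iff_continuousAt]
    intro y
    exact ContinuousAt.comp (f := fun y : ℝ => (τ + y * Complex.I : ℂ))
      (hF _ (by simpa using hτ)).continuousAt (by fun_prop)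
  · simpa using hC (τ + y * Complex.I) (by simpa using hτ)

theorem integral_vertical_line_eq {F : ℂ → ℂ} {ρ C τ : ℝ} (hτ : |τ| ≤ ρ)
    (hF : ∀ z : ℂ, |z.re| ≤ ρ → DifferentiableAt ℂ F z)
    (hC : ∀ z : ℂ, |z.re| ≤ ρ → ‖F z‖ ≤ C * (1 + z.im ^ 2)⁻¹) :
    ∫ y : ℝ, F (y * Complex.I) = ∫ y : ℝ, F (τ + y * Complex.I) := by
  have hρ : 0 ≤ ρ := (abs_nonneg τ).trans hτ
  have hi0 := integrable_vertical_line (τ := 0) (by simpa using hρ) hF hC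
  have hiτ := integrable_vertical_line hτ hF hC
  have hl0 := intervalIntegral_tendsto_integral hi0 tendsto_neg_atTop_atBot tendsto_id
  have hlτ := intervalIntegral_tendsto_integral hiτ tendsto_neg_atTop_atBot tendsto_id
  have hmem : ∀ x ∈ uIcc 0 τ, |x| ≤ ρ := fun x hx => by
    have := abs_sub_left_of_mem_uIcc hx
    simp only [sub_zero] at this
    exact this.trans hτ
  have hz : ∀ s : ℝ, s = 1 ∨ s = -1 →
      Tendsto (fun T : ℝ => ∫ x : ℝ in (0 : ℝ)..τ, F (x + (s * T : ℝ) * Complex.I)) atTop (𝓝 0) := by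
    intro s hs
    have hs2 : s ^ 2 = 1 := by rcases hs with rfl | rfl <;> norm_num
    have hb : ∀ T : ℝ, ‖∫ x : ℝ in (0 : ℝ)..τ, F (x + (s * T : ℝ) * Complex.I)‖ ≤
        C * (1 + T ^ 2)⁻¹ * |τ - 0| := fun T => by
      refine intervalIntegral.norm_integral_le_of_norm_le_const fun x hx => ?_
      have := hC (x + (s * T : ℝ) * Complex.I)
        (by simpa using hmem x (uIoc_subset_uIcc hx))
      simpa [mul_pow, hs2] using this
    refine squeeze_zero_norm hb ?_
    have : Tendsto (fun T : ℝ => (1 + T ^ 2)⁻¹) atTop (𝓝 0) :=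
      tendsto_inv_atTop_zero.comp (tendsto_atTop_add_const_left _ _ (tendsto_pow_atTop two_ne_zero))
    simpa using (this.const_mul C).mul_const |τ - 0|
  have hrect : ∀ T : ℝ, (∫ y : ℝ in -T..T, F (τ + y * Complex.I)) -
      (∫ y : ℝ in -T..T, F ((0 : ℝ) + y * Complex.I)) =
      Complex.I * ((∫ x : ℝ in (0 : ℝ)..τ, F (x + (-1 * T : ℝ) * Complex.I)) -
        ∫ x : ℝ in (0 : ℝ)..τ, F (x + (1 * T : ℝ) * Complex.I)) := fun T => by
    have h := Complex.integral_boundary_rect_eq_zero_of_differentiableOn F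
      (⟨0, -T⟩ : ℂ) (⟨τ, T⟩ : ℂ) (fun z hz => (hF z (hmem _ hz.1)).differentiableWithinAt)
    simp only [smul_eq_mul] at h
    simp only [neg_mul, one_mul]
    linear_combination (-Complex.I) * h + ((∫ y : ℝ in -T..T, F (τ + y * Complex.I))
      - (∫ y : ℝ in -T..T, F ((0 : ℝ) + y * Complex.I))) * Complex.I_mul_I
  have hlim := hlτ.sub hl0
  have hlim' := ((hz (-1) (.inr rfl)).sub (hz 1 (.inl rfl))).const_mul Complex.I
  simp only [id] at hlim
  rw [funext hrect] at hlim
  have := tendsto_nhds_unique hlim hlim'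
  rw [sub_zero, mul_zero, sub_eq_zero] at this
  simpa using this.symm

/-! ### One-sided exponentials -/

/-- The one-sided exponential `|a| e^{-(ax + 1)}`, supported where `ax + 1 > 0`. -/
noncomputable def oneSidedExp (a x : ℝ) : ℝ :=
  |a| * (Ioi (0 : ℝ)).indicator (fun u => Real.exp (-u)) (a * x + 1)

theorem integrable_oneSidedExp {a : ℝ} (ha : a ≠ 0) : Integrable (oneSidedExp a) := by
  have h : Integrable ((Ioi (0 : ℝ)).indicator fun u => Real.exp (-u)) :=
    (integrable_indicator_iff measurableSet_Ioi).2 (integrableOn_exp_neg_Ioi 0)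
  exact ((h.comp_add_right 1).comp_mul_left' ha).const_mul |a|

theorem fourier_oneSidedExp {a : ℝ} (ha : a ≠ 0) (ω : ℝ) :
    𝓕 (fun x => (oneSidedExp a x : ℂ)) ω = tpFactor a ω := by
  have haC : (a : ℂ) ≠ 0 := by exact_mod_cast ha
  set c : ℂ := 2 * Real.pi * Complex.I * ω / a with hc
  have hcre : c.re = 0 := by
    have : c = ((2 * Real.pi * ω / a : ℝ) : ℂ) * Complex.I := by rw [hc]; push_cast; ring
    simp [this]
  let Φ : ℝ → ℂ := (Ioi (0 : ℝ)).indicator fun u => Complex.exp c * Complex.exp (-(1 + c) * u)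
  have h1 : ∫ u, Φ u = Complex.exp c / (1 + c) := by
    have hne : 1 + c ≠ 0 := fun h => by
      have := congrArg Complex.re h
      simp [hcre] at this
    rw [integral_indicator measurableSet_Ioi, integral_const_mul,
      integral_exp_mul_complex_Ioi (by simp [hcre])]
    simp only [Complex.ofReal_zero, mul_zero, Complex.exp_zero]
    field_simp
  have h2 : ∀ x : ℝ, Complex.exp (↑(-2 * Real.pi * x * ω) * Complex.I) • (oneSidedExp a x : ℂ) =
      |a| * Φ (a * x + 1) := fun x => by
    simp only [oneSidedExp, Φ, indicator_apply, smul_eq_mul]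
    split_ifs
    · push_cast
      rw [mul_left_comm, ← Complex.exp_add, ← Complex.exp_add]
      congr 2
      rw [hc]
      field_simp
      ring
    · simp
  rw [Real.fourier_real_eq_integral_exp_smul, integral_congr_ae (.of_forall h2),
    integral_const_mul, Measure.integral_comp_mul_left (fun u => Φ (u + 1)) a,
    integral_add_right_eq_self Φ 1, h1, tpFactor, ← hc, abs_inv, Complex.real_smul, ← mul_assoc,
    ← Complex.ofReal_mul, mul_inv_cancel₀ (abs_ne_zero.2 ha), Complex.ofReal_one, one_mul]

theorem oneSidedExp_le {a σ : ℝ} (hσ : σ ≤ |a|) (x : ℝ) :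
    oneSidedExp a x ≤ |a| * (Real.exp 1 * Real.exp (-(σ * |x|))) := by
  refine mul_le_mul_of_nonneg_left ?_ (abs_nonneg a)
  rw [indicator_apply, ← Real.exp_add]
  split_ifs with h
  · refine Real.exp_le_exp.2 ?_
    have h1 : σ * |x| ≤ |a * x| := by
      rw [abs_mul]
      exact mul_le_mul_of_nonneg_right hσ (abs_nonneg x)
    rw [mem_Ioi] at h
    rcases abs_cases (a * x) with h2 | h2 <;> linarith
  · positivity

/-! ### The factors of the Laplace transform -/

/-- The factor `e^{z/b} / (1 + z/b)` as a function of a complex variable. -/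
noncomputable def expFactor (b : ℝ) (z : ℂ) : ℂ := Complex.exp (z / b) / (1 + z / b)

theorem tpFactor_eq_expFactor (a ω : ℝ) :
    tpFactor a ω = expFactor (a / (2 * Real.pi)) (ω * Complex.I) := by
  have : (2 * Real.pi * Complex.I * ω / a : ℂ) = ω * Complex.I / (a / (2 * Real.pi) : ℝ) := by
    push_cast
    rw [div_div_eq_mul_div]
    ring
  rw [tpFactor, expFactor, this]

section Factor

variable {ρ β b : ℝ} {z : ℂ}

theorem abs_re_div_le (hρ : ρ < β) (hb : β ≤ |b|) (hz : |z.re| ≤ ρ) :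
    |(z / b).re| ≤ ρ / β := by
  have hρ0 : 0 ≤ ρ := (abs_nonneg _).trans hz
  have : 0 < β := hρ0.trans_lt hρ
  rw [Complex.div_ofReal_re, abs_div]
  gcongr

theorem one_sub_le_norm_one_add (hρ : ρ < β) (hb : β ≤ |b|) (hz : |z.re| ≤ ρ) :
    1 - ρ / β ≤ ‖1 + z / b‖ := by
  have h1 := abs_le.1 (abs_re_div_le hρ hb hz)
  have h2 := Complex.re_le_norm (1 + z / b)
  simp only [Complex.add_re, Complex.one_re] at h2
  linarith [h1.1]

theorem one_sub_div_pos (hρ : ρ < β) (hz : |z.re| ≤ ρ) : 0 < 1 - ρ / β := by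
  have hρ0 : 0 ≤ ρ := (abs_nonneg _).trans hz
  rw [sub_pos, div_lt_one (hρ0.trans_lt hρ)]
  exact hρ

theorem differentiableAt_expFactor (hρ : ρ < β) (hb : β ≤ |b|) (hz : |z.re| ≤ ρ) :
    DifferentiableAt ℂ (expFactor b) z := by
  have hne : 1 + z / b ≠ 0 := norm_pos_iff.1
    ((one_sub_div_pos hρ hz).trans_le (one_sub_le_norm_one_add hρ hb hz))
  unfold expFactor
  fun_prop (disch := exact hne)

theorem norm_expFactor_le_exp (hρ : ρ < β) (hb : β ≤ |b|) (hz : |z.re| ≤ ρ) :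
    ‖expFactor b z‖ ≤ Real.exp (ρ ^ 2 / (1 - ρ / β) * (b ^ 2)⁻¹) := by
  have hq := one_sub_div_pos hρ hz
  set u := (z / b).re with hu
  have h1 := abs_le.1 (abs_re_div_le hρ hb hz)
  rw [← hu] at h1
  have h2 := Complex.re_le_norm (1 + z / b)
  simp only [Complex.add_re, Complex.one_re, ← hu] at h2
  have h3 : 0 < 1 + u := by linarith [h1.1]
  have h4 : Real.exp (u / (1 + u)) ≤ 1 + u := by
    have := Real.add_one_le_exp (-(u / (1 + u)))
    have h5 : -(u / (1 + u)) + 1 = (1 + u)⁻¹ := by field_simp; ring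
    rw [h5, Real.exp_neg] at this
    exact (inv_le_inv₀ h3 (Real.exp_pos _)).1 this
  have h5 : u ^ 2 ≤ ρ ^ 2 * (b ^ 2)⁻¹ := by
    rw [hu, Complex.div_ofReal_re, div_pow, div_eq_mul_inv]
    gcongr ?_ * _
    exact sq_le_sq' (abs_le.1 hz).1 (abs_le.1 hz).2
  calc ‖expFactor b z‖ = Real.exp u / ‖1 + z / b‖ := by
        rw [expFactor, norm_div, Complex.norm_exp]
    _ ≤ Real.exp u / Real.exp (u / (1 + u)) := by
        gcongr
        exact h4.trans h2
    _ = Real.exp (u ^ 2 / (1 + u)) := by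
        rw [← Real.exp_sub]
        congr 1
        field_simp
        ring
    _ ≤ _ := by
        refine Real.exp_le_exp.2 ?_
        rw [div_mul_eq_mul_div]
        gcongr
        linarith [h1.1]

theorem norm_expFactor_le_div (hρ : ρ < β) (hb : β ≤ |b|) (hz : |z.re| ≤ ρ) :
    ‖expFactor b z‖ ≤ Real.exp 1 * ((1 - ρ / β)⁻¹ + |b|) / (1 + |z.im|) := by
  have hq := one_sub_div_pos hρ hz
  have hb0 : 0 < |b| := (((abs_nonneg _).trans hz).trans_lt hρ).trans_le hb
  have h1 := abs_le.1 (abs_re_div_le hρ hb hz)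
  have h2 := one_sub_le_norm_one_add hρ hb hz
  have h3 : |z.im| ≤ |b| * ‖1 + z / b‖ := by
    have := Complex.abs_im_le_norm (1 + z / b)
    simp only [Complex.add_im, Complex.one_im, zero_add, Complex.div_ofReal_im, abs_div] at this
    rwa [div_le_iff₀' hb0] at this
  have h4 : 1 ≤ (1 - ρ / β)⁻¹ * ‖1 + z / b‖ := by
    rw [← div_eq_inv_mul, one_le_div hq]
    exact h2
  rw [expFactor, norm_div, Complex.norm_exp, div_le_div_iff₀ (hq.trans_le h2) (by positivity),
    mul_assoc]
  gcongr
  · linarith [h1.2]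
  · linarith

theorem norm_expFactor_sub_one_le (hρ : ρ < β) (hb : β ≤ |b|) (hz : |z.re| ≤ ρ)
    (hzb : ‖z‖ ≤ |b|) :
    ‖expFactor b z - 1‖ ≤ ‖z‖ ^ 2 / (1 - ρ / β) * (b ^ 2)⁻¹ := by
  have hq := one_sub_div_pos hρ hz
  have h2 := one_sub_le_norm_one_add hρ hb hz
  have hne : 1 + z / b ≠ 0 := norm_pos_iff.1 (hq.trans_le h2)
  have hn : ‖z / b‖ = ‖z‖ / |b| := by simp
  have h3 := Complex.norm_exp_sub_one_sub_id_le (x := z / b)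
    (by rw [hn]; exact div_le_one_of_le₀ hzb (abs_nonneg _))
  have h4 : expFactor b z - 1 = (Complex.exp (z / b) - 1 - z / b) / (1 + z / b) := by
    rw [expFactor]
    generalize z / b = w at *
    field_simp
    ring
  rw [h4, norm_div, div_mul_eq_mul_div]
  gcongr
  rw [hn, div_pow, sq_abs] at h3
  exact h3

end Factor

section Product

variable {ρ β : ℝ} {b : ℕ → ℝ}

theorem multipliable_expFactor (hb : ∀ ν, β ≤ |b ν|) (hs : Summable fun ν => ((b ν) ^ 2)⁻¹)
    (hρ : ρ < β) {z : ℂ} (hz : |z.re| ≤ ρ) : Multipliable fun ν => expFactor (b ν) z := by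
  have hβ : 0 < β := ((abs_nonneg _).trans hz).trans_lt hρ
  have hev : ∀ᶠ ν in cofinite, ‖z‖ ≤ |b ν| := by
    have h : Tendsto (fun ν => ((b ν) ^ 2)⁻¹) cofinite (𝓝 0) := hs.tendsto_cofinite_zero
    have hpos : 0 < ((‖z‖ + 1) ^ 2)⁻¹ := by positivity
    filter_upwards [h.eventually_lt_const hpos] with ν hν
    have hbν : 0 < (b ν) ^ 2 := by
      have : b ν ≠ 0 := abs_pos.1 (hβ.trans_le (hb ν))
      positivity
    have := (inv_lt_inv₀ hbν (by positivity)).1 hν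
    rw [← sq_abs (b ν)] at this
    have := lt_of_pow_lt_pow_left₀ 2 (abs_nonneg _) this
    linarith
  have := multipliable_one_add_of_summable (f := fun ν => expFactor (b ν) z - 1)
    (Summable.of_norm_bounded_eventually (hs.mul_left (‖z‖ ^ 2 / (1 - ρ / β)))
      (hev.mono fun ν hν => by
        simpa using norm_expFactor_sub_one_le hρ (hb ν) hz hν))
  simpa using this

theorem exists_norm_prod_expFactor_le (hb : ∀ ν, β ≤ |b ν|)
    (hs : Summable fun ν => ((b ν) ^ 2)⁻¹) (hρ : ρ < β) :
    ∃ C, ∀ n, 2 ≤ n → ∀ z : ℂ, |z.re| ≤ ρ →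
      ‖∏ ν ∈ Finset.range n, expFactor (b ν) z‖ ≤ C * (1 + z.im ^ 2)⁻¹ := by
  set c := ρ ^ 2 / (1 - ρ / β)
  set K : ℕ → ℝ := fun ν => Real.exp 1 * ((1 - ρ / β)⁻¹ + |b ν|)
  refine ⟨K 0 * K 1 * Real.exp (c * ∑' ν, ((b ν) ^ 2)⁻¹), fun n hn z hz => ?_⟩
  have hq := one_sub_div_pos hρ hz
  have hK : ∀ ν, 0 ≤ K ν := fun ν => by positivity
  obtain ⟨m, rfl⟩ := Nat.exists_eq_add_of_le hn
  have h1 : ‖∏ ν ∈ Finset.range m, expFactor (b (2 + ν)) z‖ ≤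
      Real.exp (c * ∑' ν, ((b ν) ^ 2)⁻¹) := by
    rw [norm_prod]
    calc ∏ ν ∈ Finset.range m, ‖expFactor (b (2 + ν)) z‖
        ≤ ∏ ν ∈ Finset.range m, Real.exp (c * ((b (2 + ν)) ^ 2)⁻¹) :=
          Finset.prod_le_prod (fun _ _ => norm_nonneg _)
            fun ν _ => norm_expFactor_le_exp hρ (hb _) hz
      _ = Real.exp (c * ∑ ν ∈ Finset.range m, ((b (2 + ν)) ^ 2)⁻¹) := by
          rw [← Real.exp_sum, Finset.mul_sum]
      _ ≤ _ := by
          gcongr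
          have h := hs.sum_le_tsum (Finset.range (2 + m)) fun ν _ => by positivity
          rw [Finset.sum_range_add] at h
          have : 0 ≤ ∑ ν ∈ Finset.range 2, ((b ν) ^ 2)⁻¹ :=
            Finset.sum_nonneg fun ν _ => by positivity
          linarith
  have h2 : K 0 / (1 + |z.im|) * (K 1 / (1 + |z.im|)) ≤ K 0 * K 1 * (1 + z.im ^ 2)⁻¹ := by
    rw [div_mul_div_comm, div_eq_mul_inv]
    have : 0 ≤ K 0 * K 1 := mul_nonneg (hK 0) (hK 1)
    gcongr
    nlinarith [sq_abs z.im, abs_nonneg z.im]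
  rw [Finset.prod_range_add, norm_mul, Finset.prod_range_succ, Finset.prod_range_one, norm_mul]
  calc ‖expFactor (b 0) z‖ * ‖expFactor (b 1) z‖ *
        ‖∏ ν ∈ Finset.range m, expFactor (b (2 + ν)) z‖
      ≤ K 0 / (1 + |z.im|) * (K 1 / (1 + |z.im|)) * Real.exp (c * ∑' ν, ((b ν) ^ 2)⁻¹) := by
        have := hK 0
        have := hK 1
        gcongr
        · exact norm_expFactor_le_div hρ (hb _) hz
        · exact norm_expFactor_le_div hρ (hb _) hz
    _ ≤ K 0 * K 1 * (1 + z.im ^ 2)⁻¹ * Real.exp (c * ∑' ν, ((b ν) ^ 2)⁻¹) := by gcongr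
    _ = _ := by ring

end Product

/-! ### Inverse Laplace transforms along vertical lines -/

/-- The integral of `e^{2πxz} G(z)` along the line `Re z = τ`. -/
noncomputable def lineIntegral (G : ℂ → ℂ) (τ x : ℝ) : ℂ :=
  ∫ ω : ℝ, Complex.exp (2 * Real.pi * x * (τ + ω * Complex.I)) * G (τ + ω * Complex.I)

theorem norm_exp_line (τ x ω : ℝ) :
    ‖Complex.exp (2 * Real.pi * x * (τ + ω * Complex.I))‖ = Real.exp (2 * Real.pi * x * τ) := by
  have : (2 * Real.pi * x * (τ + ω * Complex.I) : ℂ) =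
      (2 * Real.pi * x * τ : ℝ) + (2 * Real.pi * x * ω : ℝ) * Complex.I := by push_cast; ring
  rw [Complex.norm_exp, this]
  simp

theorem fourierInv_eq_lineIntegral (G : ℂ → ℂ) (x : ℝ) :
    𝓕⁻ (fun ω : ℝ => G (ω * Complex.I)) x = lineIntegral G 0 x := by
  rw [Real.fourierInv_eq', lineIntegral]
  refine integral_congr_ae (.of_forall fun ω => ?_)
  simp only [smul_eq_mul, Complex.ofReal_zero, zero_add, RCLike.inner_apply, conj_trivial]
  congr 2
  push_cast
  ring

theorem norm_lineIntegral_le (G : ℂ → ℂ) (τ x : ℝ) :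
    ‖lineIntegral G τ x‖ ≤
      Real.exp (2 * Real.pi * x * τ) * ∫ ω : ℝ, ‖G (τ + ω * Complex.I)‖ := by
  rw [← integral_const_mul]
  refine (norm_integral_le_integral_norm _).trans_eq ?_
  simp only [norm_mul, norm_exp_line]

theorem integrable_lineIntegral {G : ℂ → ℂ} {τ : ℝ}
    (hG : Integrable fun ω : ℝ => G (τ + ω * Complex.I)) (x : ℝ) :
    Integrable fun ω : ℝ =>
      Complex.exp (2 * Real.pi * x * (τ + ω * Complex.I)) * G (τ + ω * Complex.I) := by
  refine hG.bdd_mul (c := Real.exp (2 * Real.pi * x * τ)) ?_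
    (.of_forall fun ω => (norm_exp_line τ x ω).le)
  exact Continuous.aestronglyMeasurable (by fun_prop)

theorem lineIntegral_sub {G H : ℂ → ℂ} {τ : ℝ}
    (hG : Integrable fun ω : ℝ => G (τ + ω * Complex.I))
    (hH : Integrable fun ω : ℝ => H (τ + ω * Complex.I)) (x : ℝ) :
    lineIntegral (G - H) τ x = lineIntegral G τ x - lineIntegral H τ x := by
  rw [lineIntegral, lineIntegral, lineIntegral,
    ← integral_sub (integrable_lineIntegral hG x) (integrable_lineIntegral hH x)]
  simp only [Pi.sub_apply, mul_sub]

theorem lineIntegral_zero_eq {G : ℂ → ℂ} {ρ C τ : ℝ} (hτ : |τ| ≤ ρ)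
    (hG : ∀ z : ℂ, |z.re| ≤ ρ → DifferentiableAt ℂ G z)
    (hC : ∀ z : ℂ, |z.re| ≤ ρ → ‖G z‖ ≤ C * (1 + z.im ^ 2)⁻¹) (x : ℝ) :
    lineIntegral G 0 x = lineIntegral G τ x := by
  have h := integral_vertical_line_eq (F := fun z => Complex.exp (2 * Real.pi * x * z) * G z)
    (C := Real.exp (2 * Real.pi * |x| * ρ) * C) hτ
    (fun z hz => by have := hG z hz; fun_prop) fun z hz => by
      rw [norm_mul, mul_assoc (Real.exp _)]
      refine mul_le_mul ?_ (hC z hz) (norm_nonneg _) (Real.exp_pos _).le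
      have := norm_exp_line z.re x z.im
      rw [Complex.re_add_im] at this
      rw [this, Real.exp_le_exp, mul_assoc, mul_assoc _ |x|]
      have h1 : x * z.re ≤ |x| * ρ :=
        (le_abs_self _).trans ((abs_mul _ _).trans_le (by gcongr))
      have := Real.pi_pos
      gcongr
  simpa [lineIntegral] using h

/-- The data obtained by passing to the limit in a sequence of functions that are holomorphic and
uniformly of order `1 / (1 + y ^ 2)` on a strip. -/
theorem exists_lineIntegral_bounds {G : ℂ → ℂ} {Gn : ℕ → ℂ → ℂ} {ρ C : ℝ} (hρ : 0 ≤ ρ)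
    (hd : ∀ n, 2 ≤ n → ∀ z : ℂ, |z.re| ≤ ρ → DifferentiableAt ℂ (Gn n) z)
    (hC : ∀ n, 2 ≤ n → ∀ z : ℂ, |z.re| ≤ ρ → ‖Gn n z‖ ≤ C * (1 + z.im ^ 2)⁻¹)
    (hlim : ∀ z : ℂ, |z.re| ≤ ρ → Tendsto (fun n => Gn n z) atTop (𝓝 (G z))) :
    (Integrable fun ω : ℝ => G (ω * Complex.I)) ∧
    ∃ B : ℝ, ∃ δ : ℕ → ℝ, Tendsto δ atTop (𝓝 0) ∧
      (∀ x, ‖lineIntegral G 0 x‖ ≤ B * Real.exp (-(2 * Real.pi * ρ * |x|))) ∧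
      (∀ n, 2 ≤ n → ∀ x, ‖lineIntegral (Gn n) 0 x‖ ≤ B * Real.exp (-(2 * Real.pi * ρ * |x|))) ∧
      ∀ n, 2 ≤ n → ∀ x, ‖lineIntegral (Gn n) 0 x - lineIntegral G 0 x‖ ≤
        δ n * Real.exp (-(2 * Real.pi * ρ * |x|)) := by
  have hint : ∀ n, 2 ≤ n → ∀ τ : ℝ, |τ| ≤ ρ → Integrable fun ω : ℝ => Gn n (τ + ω * Complex.I) :=
    fun n hn τ hτ => integrable_vertical_line hτ (hd n hn) (hC n hn)
  have hGC : ∀ z : ℂ, |z.re| ≤ ρ → ‖G z‖ ≤ C * (1 + z.im ^ 2)⁻¹ := fun z hz =>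
    le_of_tendsto (hlim z hz).norm (eventually_atTop.2 ⟨2, fun n hn => hC n hn z hz⟩)
  have hGint : ∀ τ : ℝ, |τ| ≤ ρ → Integrable fun ω : ℝ => G (τ + ω * Complex.I) := by
    intro τ hτ
    refine (integrable_inv_one_add_sq.const_mul C).mono' ?_ (.of_forall fun ω => ?_)
    · refine aestronglyMeasurable_of_tendsto_ae atTop
        (f := fun n (ω : ℝ) => Gn (n + 2) (τ + ω * Complex.I))
        (fun n => (hint (n + 2) (by omega) τ hτ).1) (.of_forall fun ω => ?_)
      exact (tendsto_add_atTop_iff_nat 2).2 (hlim (τ + ω * Complex.I) (by simpa using hτ))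
    · simpa using hGC (τ + ω * Complex.I) (by simpa using hτ)
  have hδ : ∀ τ : ℝ, |τ| ≤ ρ →
      Tendsto (fun n => ∫ ω : ℝ, ‖(Gn n - G) (τ + ω * Complex.I)‖) atTop (𝓝 0) := by
    intro τ hτ
    rw [← tendsto_add_atTop_iff_nat 2]
    have := tendsto_integral_of_dominated_convergence (μ := volume)
      (F := fun n (ω : ℝ) => ‖(Gn (n + 2) - G) (τ + ω * Complex.I)‖) (f := fun _ => (0 : ℝ))
      (fun ω => 2 * (C * (1 + ω ^ 2)⁻¹))
      (fun n => ((hint (n + 2) (by omega) τ hτ).sub (hGint τ hτ)).norm.1)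
      ((integrable_inv_one_add_sq.const_mul C).const_mul 2)
      (fun n => .of_forall fun ω => by
        have h1 := hC (n + 2) (by omega) (τ + ω * Complex.I) (by simpa using hτ)
        have h2 := hGC (τ + ω * Complex.I) (by simpa using hτ)
        have h3 := norm_sub_le (Gn (n + 2) (τ + ω * Complex.I)) (G (τ + ω * Complex.I))
        simp at h1 h2
        rw [norm_norm, Pi.sub_apply]
        linarith)
      (.of_forall fun ω => by
        have h1 := (tendsto_add_atTop_iff_nat 2).2
          (hlim (τ + ω * Complex.I) (by simpa using hτ))
        simpa using (h1.sub_const (G (τ + ω * Complex.I))).norm)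
    simpa using this
  have hshift : ∀ n, 2 ≤ n → ∀ τ : ℝ, |τ| ≤ ρ → ∀ x,
      lineIntegral (Gn n) 0 x = lineIntegral (Gn n) τ x :=
    fun n hn τ hτ x => lineIntegral_zero_eq hτ (hd n hn) (hC n hn) x
  have hconv : ∀ τ : ℝ, |τ| ≤ ρ → ∀ x,
      Tendsto (fun n => lineIntegral (Gn n) τ x) atTop (𝓝 (lineIntegral G τ x)) := by
    intro τ hτ x
    rw [tendsto_iff_norm_sub_tendsto_zero]
    refine squeeze_zero' (.of_forall fun _ => norm_nonneg _) (eventually_atTop.2 ⟨2, fun n hn => ?_⟩)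
      (by simpa using (hδ τ hτ).const_mul (Real.exp (2 * Real.pi * x * τ)))
    rw [← lineIntegral_sub (hint n hn τ hτ) (hGint τ hτ)]
    exact norm_lineIntegral_le _ _ _
  have h00 : |(0 : ℝ)| ≤ ρ := by simpa using hρ
  have hshiftG : ∀ τ : ℝ, |τ| ≤ ρ → ∀ x, lineIntegral G 0 x = lineIntegral G τ x := by
    intro τ hτ x
    refine tendsto_nhds_unique (hconv 0 h00 x) ((hconv τ hτ x).congr' ?_)
    exact eventually_atTop.2 ⟨2, fun n hn => (hshift n hn τ hτ x).symm⟩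
  have hτx : ∀ x : ℝ, ∃ τ : ℝ, (τ = ρ ∨ τ = -ρ) ∧ |τ| ≤ ρ ∧
      2 * Real.pi * x * τ = -(2 * Real.pi * ρ * |x|) := by
    intro x
    rcases abs_cases x with h | h
    · exact ⟨-ρ, .inr rfl, by simp [abs_of_nonneg hρ], by rw [h.1]; ring⟩
    · exact ⟨ρ, .inl rfl, by simp [abs_of_nonneg hρ], by rw [h.1]; ring⟩
  have hbd : ∀ (H : ℂ → ℂ) (τ x : ℝ), |τ| ≤ ρ →
      2 * Real.pi * x * τ = -(2 * Real.pi * ρ * |x|) →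
      (∀ z : ℂ, |z.re| ≤ ρ → ‖H z‖ ≤ C * (1 + z.im ^ 2)⁻¹) →
      (Integrable fun ω : ℝ => H (τ + ω * Complex.I)) →
      ‖lineIntegral H τ x‖ ≤ (∫ ω : ℝ, C * (1 + ω ^ 2)⁻¹) *
        Real.exp (-(2 * Real.pi * ρ * |x|)) := by
    intro H τ x hτ hx hH hHi
    refine (norm_lineIntegral_le H τ x).trans ?_
    rw [hx, mul_comm]
    gcongr
    · exact hHi.norm
    · exact integrable_inv_one_add_sq.const_mul C
    · intro ω
      simpa using hH (τ + ω * Complex.I) (by simpa using hτ)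
  refine ⟨by simpa using hGint 0 h00, ∫ ω : ℝ, C * (1 + ω ^ 2)⁻¹,
    fun n => (∫ ω : ℝ, ‖(Gn n - G) ((ρ : ℝ) + ω * Complex.I)‖) +
      ∫ ω : ℝ, ‖(Gn n - G) ((-ρ : ℝ) + ω * Complex.I)‖, ?_, ?_, ?_, ?_⟩
  · simpa using (hδ ρ (by simp [abs_of_nonneg hρ])).add (hδ (-ρ) (by simp [abs_of_nonneg hρ]))
  · intro x
    obtain ⟨τ, -, hτ, hx⟩ := hτx x
    rw [hshiftG τ hτ]
    exact hbd G τ x hτ hx hGC (hGint τ hτ)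
  · intro n hn x
    obtain ⟨τ, -, hτ, hx⟩ := hτx x
    rw [hshift n hn τ hτ]
    exact hbd (Gn n) τ x hτ hx (hC n hn) (hint n hn τ hτ)
  · intro n hn x
    obtain ⟨τ, hτ', hτ, hx⟩ := hτx x
    rw [hshift n hn τ hτ, hshiftG τ hτ, ← lineIntegral_sub (hint n hn τ hτ) (hGint τ hτ)]
    refine (norm_lineIntegral_le _ τ x).trans ?_
    rw [hx, mul_comm]
    gcongr
    have hnn : ∀ σ : ℝ, 0 ≤ ∫ ω : ℝ, ‖(Gn n - G) (σ + ω * Complex.I)‖ := fun σ =>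
      integral_nonneg fun _ => norm_nonneg _
    rcases hτ' with rfl | rfl
    · exact le_add_of_nonneg_right (hnn _)
    · exact le_add_of_nonneg_left (hnn _)

/-! ### Exponential decay of totally positive functions -/

theorem tpFactor_zero (a : ℝ) : tpFactor a 0 = 1 := by simp [tpFactor]

theorem not_ae_eq_zero_of_fourier_ne_zero {g : ℝ → ℝ} {ω : ℝ}
    (h : 𝓕 (fun x => (g x : ℂ)) ω ≠ 0) : ¬ g =ᵐ[volume] 0 := by
  intro h0
  have h1 : (fun x => (g x : ℂ)) =ᵐ[volume] fun _ => 0 := by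
    filter_upwards [h0] with x hx
    simp [hx]
  refine h ?_
  rw [Real.fourier_congr_ae h1]
  simp [Real.fourier_eq]

theorem IsTPOfFiniteType.not_ae_eq_zero {a : ℕ → ℝ} {n : ℕ} {g : ℝ → ℝ}
    (hg : IsTPOfFiniteType a n g) : ¬ g =ᵐ[volume] 0 :=
  not_ae_eq_zero_of_fourier_ne_zero (ω := 0) (by simp [hg.fourier_eq, tpFactor_zero])

theorem IsTPOfInfiniteType.not_ae_eq_zero {a : ℕ → ℝ} {g : ℝ → ℝ}
    (hg : IsTPOfInfiniteType a g) : ¬ g =ᵐ[volume] 0 :=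
  not_ae_eq_zero_of_fourier_ne_zero (ω := 0) (by simp [hg.fourier_eq, tpFactor_zero])

theorem IsTotallyPositive.eq_re_lineIntegral {g : ℝ → ℝ} (hg : IsTotallyPositive g)
    (h0 : ¬ g =ᵐ[volume] 0) (hgi : Integrable g) {G : ℂ → ℂ}
    (hG : Integrable fun ω : ℝ => G (ω * Complex.I))
    (h : ∀ ω : ℝ, 𝓕 (fun x => (g x : ℂ)) ω = G (ω * Complex.I)) (x : ℝ) :
    g x = (lineIntegral G 0 x).re := by
  have hae := ae_eq_fourierInv_of_fourier_eq hgi.ofReal hG h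
  simp only [fourierInv_eq_lineIntegral] at hae
  refine hg.eq_of_ae_eq h0 (h := fun x => (lineIntegral G 0 x).re) ?_ ?_ x
  · have := continuous_fourierInv_of_integrable hG
    simp only [funext (fourierInv_eq_lineIntegral G)] at this
    exact Complex.continuous_re.comp this
  · filter_upwards [hae] with x hx
    exact congrArg Complex.re hx

theorem IsTPOfFiniteType.exists_le_of_type_one {a : ℕ → ℝ} {g : ℝ → ℝ}
    (hg : IsTPOfFiniteType a 1 g) (ha : a 0 ≠ 0) {σ : ℝ} (hσ : σ ≤ |a 0|) :
    ∃ B, ∀ x, |g x| ≤ B * Real.exp (-(σ * |x|)) := by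
  have hE := integrable_oneSidedExp ha
  have hsub : ∀ ω : ℝ, 𝓕 (fun x => ((g x - oneSidedExp (a 0) x : ℝ) : ℂ)) ω = 0 := by
    intro ω
    have h1 : Integrable fun x => (g x : ℂ) := hg.integrable.ofReal
    have h2 : Integrable fun x => (oneSidedExp (a 0) x : ℂ) := hE.ofReal
    have h3 := hg.fourier_eq ω
    have h4 := fourier_oneSidedExp ha ω
    rw [Finset.prod_range_one] at h3
    rw [Real.fourier_eq] at h3 h4 ⊢
    simp only [Complex.ofReal_sub, smul_sub]
    rw [integral_sub ((Real.fourierIntegral_convergent_iff ω).2 h1)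
      ((Real.fourierIntegral_convergent_iff ω).2 h2), h3, h4, sub_self]
  have hae := ae_eq_fourierInv_of_fourier_eq (hg.integrable.sub hE).ofReal
    (integrable_zero ℝ ℂ volume) hsub
  obtain ⟨C, hC⟩ := hg.totallyPositive.exists_le_mul_of_ae_le hg.not_ae_eq_zero
    (h := fun x => |a 0| * (Real.exp 1 * Real.exp (-(σ * |x|)))) (by fun_prop)
    (fun x => by have := abs_pos.2 ha; positivity) (by
      filter_upwards [hae] with x hx
      have h0 : g x - oneSidedExp (a 0) x = 0 := by
        have : 𝓕⁻ (0 : ℝ → ℂ) x = 0 := by simp [Real.fourierInv_eq]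
        rw [this] at hx
        exact Complex.ofReal_eq_zero.1 hx
      rw [sub_eq_zero.1 h0]
      exact oneSidedExp_le hσ x)
  refine ⟨C * (|a 0| * Real.exp 1), fun x => ?_⟩
  rw [abs_of_nonneg (hg.totallyPositive.nonneg x)]
  refine (hC x).trans_eq ?_
  ring

theorem exists_exponential_bounds {a : ℕ → ℝ} (hsum : Summable fun ν => ((a ν) ^ 2)⁻¹)
    {g : ℝ → ℝ} (hg : IsTPOfInfiniteType a g)
    {gn : ℕ → ℝ → ℝ} (hgn : ∀ n, 1 ≤ n → IsTPOfFiniteType a n (gn n))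
    {ρ β : ℝ} (hρ0 : 0 ≤ ρ) (hρ : ρ < β) (hβ : ∀ ν, β ≤ |a ν| / (2 * Real.pi)) :
    (∃ B, ∀ x, |g x| ≤ B * Real.exp (-(2 * Real.pi * ρ * |x|))) ∧
    (∀ n, 1 ≤ n → ∃ B, ∀ x, |gn n x| ≤ B * Real.exp (-(2 * Real.pi * ρ * |x|))) ∧
    ∃ δ : ℕ → ℝ, Tendsto δ atTop (𝓝 0) ∧ ∀ n, 2 ≤ n → ∀ x,
      |gn n x - g x| ≤ δ n * Real.exp (-(2 * Real.pi * ρ * |x|)) := by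
  have hπ := Real.pi_pos
  set b : ℕ → ℝ := fun ν => a ν / (2 * Real.pi) with hbdef
  have hb : ∀ ν, β ≤ |b ν| := fun ν => by
    rw [hbdef, abs_div, abs_of_pos (by positivity : 0 < 2 * Real.pi)]
    exact hβ ν
  have hs : Summable fun ν => ((b ν) ^ 2)⁻¹ := by
    refine (hsum.mul_left ((2 * Real.pi) ^ 2)).congr fun ν => ?_
    rw [hbdef, div_pow, inv_div, div_eq_mul_inv]
  obtain ⟨C, hC⟩ := exists_norm_prod_expFactor_le hb hs hρ
  obtain ⟨hGi, B, δ, hδ, hB, hBn, hdiff⟩ := exists_lineIntegral_bounds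
    (G := fun z => ∏' ν, expFactor (b ν) z)
    (Gn := fun n z => ∏ ν ∈ Finset.range n, expFactor (b ν) z) hρ0
    (fun n _ z hz => DifferentiableAt.fun_finsetProd
      fun ν _ => differentiableAt_expFactor hρ (hb ν) hz) hC
    (fun z hz => (multipliable_expFactor hb hs hρ hz).hasProd.tendsto_prod_nat)
  have hgeq := hg.totallyPositive.eq_re_lineIntegral hg.not_ae_eq_zero hg.integrable
    (G := fun z => ∏' ν, expFactor (b ν) z) hGi
    fun ω => by simp only [hg.fourier_eq, tpFactor_eq_expFactor, hbdef]
  have hgneq : ∀ n, 2 ≤ n → ∀ x, gn n x =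
      (lineIntegral (fun z => ∏ ν ∈ Finset.range n, expFactor (b ν) z) 0 x).re := by
    intro n hn
    have h := hgn n (by omega)
    refine h.totallyPositive.eq_re_lineIntegral h.not_ae_eq_zero h.integrable ?_
      fun ω => by simp only [h.fourier_eq, tpFactor_eq_expFactor, hbdef]
    simpa using integrable_vertical_line (τ := 0) (ρ := ρ) (by simpa using hρ0)
      (fun z hz => DifferentiableAt.fun_finsetProd
        fun ν _ => differentiableAt_expFactor hρ (hb ν) hz) (hC n hn)
  refine ⟨⟨B, fun x => ?_⟩, fun n hn => ?_, δ, hδ, fun n hn x => ?_⟩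
  · rw [hgeq]
    exact (Complex.abs_re_le_norm _).trans (hB x)
  · rcases hn.eq_or_lt with rfl | hn
    · have ha0 : 2 * Real.pi * ρ < |a 0| := by
        have := hρ.trans_le (hβ 0)
        rwa [lt_div_iff₀' (by positivity)] at this
      exact (hgn 1 le_rfl).exists_le_of_type_one
        (abs_pos.1 (lt_of_le_of_lt (by positivity) ha0)) ha0.le
    · refine ⟨B, fun x => ?_⟩
      rw [hgneq n hn]
      exact (Complex.abs_re_le_norm _).trans (hBn n hn x)
  · rw [hgneq n hn, hgeq, ← Complex.sub_re]
    exact (Complex.abs_re_le_norm _).trans (hdiff n hn x)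

/-! ### The Zak transform of exponentially decaying functions -/

theorem summable_exp_neg_mul_abs_int {c : ℝ} (hc : 0 < c) :
    Summable fun k : ℤ => Real.exp (-(c * |(k : ℝ)|)) := by
  have h : Summable fun n : ℕ => Real.exp (n * -c) := Real.summable_exp_nat_mul_iff.2 (by linarith)
  refine Summable.of_nat_of_neg (h.congr fun n => ?_) (h.congr fun n => ?_) <;>
  · simp [mul_comm]

theorem norm_zakTerm_le {f : ℝ → ℝ} {B ρ ξ x : ℝ}
    (hρ : 0 ≤ ρ) (hf : ∀ x, |f x| ≤ B * Real.exp (-(2 * Real.pi * ρ * |x|)))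
    (hx : x ∈ Ico (0 : ℝ) 1) {s : ℂ} (hs : s ∈ strip ξ) (k : ℤ) :
    ‖zakTerm f x s k‖ ≤ B * Real.exp (2 * Real.pi * ρ) *
      Real.exp (-(2 * Real.pi * (ρ - ξ) * |(k : ℝ)|)) := by
  have hπ := Real.pi_pos
  have hB : 0 ≤ B := by simpa using (abs_nonneg _).trans (hf 0)
  have h1 : ‖Complex.exp (-2 * Real.pi * Complex.I * k * s)‖ = Real.exp (2 * Real.pi * (k * s.im)) := by
    rw [Complex.norm_exp]
    congr 1
    have : (-2 * Real.pi * Complex.I * k * s : ℂ) =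
        ((-2 * Real.pi * k : ℝ) : ℂ) * (Complex.I * s) := by push_cast; ring
    rw [this, Complex.re_ofReal_mul]
    simp
    ring
  have h2 : (k : ℝ) * s.im ≤ ξ * |(k : ℝ)| := by
    refine (le_abs_self _).trans ?_
    rw [abs_mul, mul_comm]
    exact mul_le_mul_of_nonneg_right hs (abs_nonneg _)
  have h3 : |(k : ℝ)| ≤ |x + k| + 1 := by
    have := abs_sub (x + k) x
    have hx1 : |x| ≤ 1 := abs_le.2 ⟨by linarith [hx.1], hx.2.le⟩
    rw [add_sub_cancel_left] at this
    linarith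
  rw [zakTerm, norm_mul, Complex.norm_real, Real.norm_eq_abs, h1]
  refine (mul_le_mul_of_nonneg_right (hf _) (Real.exp_pos _).le).trans ?_
  rw [mul_assoc B, mul_assoc B, ← Real.exp_add, ← Real.exp_add]
  refine mul_le_mul_of_nonneg_left (Real.exp_le_exp.2 ?_) hB
  have h4 : ρ * |(k : ℝ)| ≤ ρ * (|x + k| + 1) := by gcongr
  have h5 : 2 * Real.pi * (-(ρ * |x + k|) + k * s.im) ≤
      2 * Real.pi * (ρ + -((ρ - ξ) * |(k : ℝ)|)) := by
    refine mul_le_mul_of_nonneg_left ?_ (by positivity)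
    linarith
  linarith

theorem summable_zakTerm {f : ℝ → ℝ} {B ρ ξ x : ℝ} (hρ : 0 ≤ ρ) (hξ : ξ < ρ)
    (hf : ∀ x, |f x| ≤ B * Real.exp (-(2 * Real.pi * ρ * |x|)))
    (hx : x ∈ Ico (0 : ℝ) 1) {s : ℂ} (hs : s ∈ strip ξ) : Summable (zakTerm f x s) := by
  have hc : 0 < 2 * Real.pi * (ρ - ξ) := mul_pos Real.two_pi_pos (sub_pos.2 hξ)
  exact Summable.of_norm_bounded ((summable_exp_neg_mul_abs_int hc).mul_left _)
    (norm_zakTerm_le hρ hf hx hs)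

theorem analyticOnNhd_zak {f : ℝ → ℝ} {B ρ ξ x : ℝ} (hρ : 0 ≤ ρ) (hξ : ξ < ρ)
    (hf : ∀ x, |f x| ≤ B * Real.exp (-(2 * Real.pi * ρ * |x|)))
    (hx : x ∈ Ico (0 : ℝ) 1) : AnalyticOnNhd ℂ (zak f x) (strip ξ) := by
  obtain ⟨η, hη, hηρ⟩ := exists_between hξ
  have hc : 0 < 2 * Real.pi * (ρ - η) := mul_pos Real.two_pi_pos (sub_pos.2 hηρ)
  have hU : IsOpen {s : ℂ | |s.im| < η} :=
    isOpen_lt (continuous_abs.comp Complex.continuous_im) continuous_const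
  have h : DifferentiableOn ℂ (zak f x) {s : ℂ | |s.im| < η} := by
    refine Complex.differentiableOn_tsum_of_summable_norm (F := fun k s => zakTerm f x s k)
      ((summable_exp_neg_mul_abs_int hc).mul_left (B * Real.exp (2 * Real.pi * ρ)))
      (fun k => ?_) hU fun k s hs => norm_zakTerm_le hρ hf hx
        (show |s.im| ≤ η from le_of_lt hs) k
    unfold zakTerm
    fun_prop
  exact (h.analyticOnNhd hU).mono fun s hs => lt_of_le_of_lt hs hη

theorem norm_zak_sub_le {f g : ℝ → ℝ} {A B D ρ ξ x : ℝ} (hρ : 0 ≤ ρ) (hξ : ξ < ρ)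
    (hf : ∀ x, |f x| ≤ A * Real.exp (-(2 * Real.pi * ρ * |x|)))
    (hg : ∀ x, |g x| ≤ B * Real.exp (-(2 * Real.pi * ρ * |x|)))
    (hfg : ∀ x, |f x - g x| ≤ D * Real.exp (-(2 * Real.pi * ρ * |x|)))
    (hx : x ∈ Ico (0 : ℝ) 1) {s : ℂ} (hs : s ∈ strip ξ) :
    ‖zak f x s - zak g x s‖ ≤ D * (Real.exp (2 * Real.pi * ρ) *
      ∑' k : ℤ, Real.exp (-(2 * Real.pi * (ρ - ξ) * |(k : ℝ)|))) := by
  have hc : 0 < 2 * Real.pi * (ρ - ξ) := mul_pos Real.two_pi_pos (sub_pos.2 hξ)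
  rw [zak, zak, ← (summable_zakTerm hρ hξ hf hx hs).tsum_sub (summable_zakTerm hρ hξ hg hx hs),
    ← mul_assoc, ← tsum_mul_left]
  refine tsum_of_norm_bounded ((summable_exp_neg_mul_abs_int hc).mul_left _).hasSum fun k => ?_
  have := norm_zakTerm_le (f := fun x => f x - g x) hρ hfg hx hs k
  simpa only [zakTerm, Complex.ofReal_sub, sub_mul] using this

theorem mainTheorem3
    (a : ℕ → ℝ) (ha : ∀ ν, a ν ≠ 0) (hsum : Summable fun ν => ((a ν) ^ 2)⁻¹)
    (g : ℝ → ℝ) (hg : IsTPOfInfiniteType a g)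
    (gn : ℕ → ℝ → ℝ) (hgn : ∀ n, 1 ≤ n → IsTPOfFiniteType a n (gn n))
    (ξ : ℝ) (hξ0 : 0 ≤ ξ) (hξ : ξ < (⨅ ν, |a ν|) / (2 * Real.pi)) :
    (∀ x₀ ∈ Ico (0 : ℝ) 1,
      (∀ s ∈ strip ξ, Summable (zakTerm g x₀ s)) ∧
      AnalyticOnNhd ℂ (zak g x₀) (strip ξ) ∧
      ∀ n, 1 ≤ n →
        (∀ s ∈ strip ξ, Summable (zakTerm (gn n) x₀ s)) ∧
        AnalyticOnNhd ℂ (zak (gn n) x₀) (strip ξ)) ∧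
    TendstoUniformlyOn (fun (n : ℕ) (p : ℝ × ℂ) => zak (gn n) p.1 p.2)
      (fun p : ℝ × ℂ => zak g p.1 p.2) atTop (Ico (0 : ℝ) 1 ×ˢ strip ξ) := by
  obtain ⟨ρ, hξρ, hρ⟩ := exists_between hξ
  have hρ0 : 0 ≤ ρ := hξ0.trans hξρ.le
  obtain ⟨⟨B, hB⟩, hBn, δ, hδ, hdiff⟩ := exists_exponential_bounds hsum hg hgn hρ0 hρ fun ν => by
    have hbdd : BddBelow (range fun ν => |a ν|) := ⟨0, by rintro _ ⟨ν, rfl⟩; exact abs_nonneg _⟩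
    have := ciInf_le hbdd ν
    have := Real.two_pi_pos
    gcongr
  refine ⟨fun x hx => ⟨fun s hs => summable_zakTerm hρ0 hξρ hB hx hs,
    analyticOnNhd_zak hρ0 hξρ hB hx, fun n hn => ?_⟩, ?_⟩
  · obtain ⟨A, hA⟩ := hBn n hn
    exact ⟨fun s hs => summable_zakTerm hρ0 hξρ hA hx hs, analyticOnNhd_zak hρ0 hξρ hA hx⟩
  · rw [Metric.tendstoUniformlyOn_iff]
    intro ε hε
    have hlim := hδ.mul_const (Real.exp (2 * Real.pi * ρ) *
      ∑' k : ℤ, Real.exp (-(2 * Real.pi * (ρ - ξ) * |(k : ℝ)|)))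
    rw [zero_mul] at hlim
    filter_upwards [hlim.eventually_lt_const hε, eventually_ge_atTop 2] with n hn hn2 p hp
    obtain ⟨A, hA⟩ := hBn n (by omega)
    rw [dist_comm, dist_eq_norm]
    exact (norm_zak_sub_le hρ0 hξρ hA hB (hdiff n hn2) hp.1 hp.2).trans_lt hn
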